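/- All rings are associative with nonzero identity, and modules are left modules unless they are written as right modules. For a ring $R$, let $\mathrm{mod}\,R$ be the category of all $R$-modules $M$ possessing a resolution $\cdots\to P_1\to P_0\to M\to 0$ by finitely generated projective $R$-modules, let $R^o$ be the opposite ring (so that $R^o$-modules are right $R$-modules), and for an $R$-module $T$ let $\mathrm{add}\,T$ be the class of all modules isomorphic to direct summands of finite direct sums of copies of $T$. Let $T$ be an $R$-module and let $S=\mathrm{End}_R T$ act on $T$ from the right. Then $T$ is called *Wakamatsu-tilting* if (1) $T\in\mathrm{mod}\,R$ and $T_S\in\mathrm{mod}\,S^o$, (2) the canonical ring homomorphism $R\to\mathrm{End}(T_S)$ is an isomorphism, and (3) $\mathrm{Ext}_R^i(T,T)=0=\mathrm{Ext}_{S^o}^i(T,T)$ for all $i>0$. It is called *tilting* if (T1) $T\in\mathrm{mod}\,R$ and $\mathrm{pd}\,T<\infty$, (T2) $\mathrm{Ext}_R^i(T,T)=0$ for all $i>0$, and (T3) for some integer $n\ge 0$ there is an exact sequence $0\to R\to T_0\to\cdots\to T_n\to 0$ with each $T_i\in\mathrm{add}\,T$. For a ring $R$, consider the following two assertions. (PWTC)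 Every Wakamatsu-tilting $R$-module of finite projective dimension is tilting. (EWTC) Every $R$-module $T\in\mathrm{mod}\,R$ that satisfies (T2) and (T3) is tilting. **Proposition.** (PWTC) holds for all rings $R$ if and only if (EWTC) holds for all rings $R$. -/

import Mathlib

open CategoryTheory

universe u

namespace WTilting

section Defs

/-- `M` belongs to `mod R`: there is an exact sequence `⋯ → P 1 → P 0 → M → 0` of left `R`-modules
in which every `P i` is finitely generated and projective. -/
def HasFGProjectiveResolution (R : Type u) [Ring R] (M : Type u) [AddCommGroup M] [Module R M] :
    Prop :=
  ∃ (P : ℕ → ModuleCat.{u} R) (d : ∀ i, P (i + 1) →ₗ[R] P i) (ε : P 0 →ₗ[R] M),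
    (∀ i, Module.Finite R (P i) ∧ Module.Projective R (P i)) ∧
      Function.Surjective ε ∧ Function.Exact (d 0) ε ∧
        ∀ i, Function.Exact (d (i + 1)) (d i)

/-- `M ∈ add T`: the module `M` is isomorphic to a direct summand of a finite direct sum of
copies of `T`. -/
def MemAdd (R : Type u) [Ring R] (T : Type u) [AddCommGroup T] [Module R T]
    (M : Type u) [AddCommGroup M] [Module R M] : Prop :=
  ∃ (n : ℕ) (p q : Submodule R (Fin n → T)), IsCompl p q ∧ Nonempty (M ≃ₗ[R] p)

/-- `Ext_R^i(T, T) = 0` for all `i > 0`. -/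
def IsSelfOrthogonal (R : Type u) [Ring R] (T : Type u) [AddCommGroup T] [Module R T] : Prop :=
  ∀ i : ℕ, 0 < i → Subsingleton (Abelian.Ext (ModuleCat.of R T) (ModuleCat.of R T) i)

/-- The projective dimension of `T` is finite. -/
def HasFiniteProjectiveDimension (R : Type u) [Ring R] (T : Type u) [AddCommGroup T]
    [Module R T] : Prop :=
  ∃ n : ℕ, HasProjectiveDimensionLE (ModuleCat.of R T) n

/-- For some `n` there is an exact sequence `0 → R → X 0 → X 1 → ⋯ → X n → 0` of left `R`-modules
with each `X i ∈ add T`. The sequence is continued by zero modules beyond `X n`, so that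
exactness at `X n` says that the map into `X n` is surjective. -/
def HasFiniteAddCoresolution (R : Type u) [Ring R] (T : Type u) [AddCommGroup T]
    [Module R T] : Prop :=
  ∃ (n : ℕ) (X : ℕ → ModuleCat.{u} R) (f : R →ₗ[R] X 0) (d : ∀ i, X i →ₗ[R] X (i + 1)),
    (∀ i, i ≤ n → MemAdd R T (X i)) ∧ (∀ i, n < i → Subsingleton (X i)) ∧
      Function.Injective f ∧ Function.Exact f (d 0) ∧
        ∀ i, Function.Exact (d i) (d (i + 1))

/-- Tilting modules (of arbitrary finite projective dimension). -/
structure IsTilting (R : Type u) [Ring R] (T : Type u) [AddCommGroup T] [Module R T] : Prop where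
  mem_mod : HasFGProjectiveResolution R T
  finite_pd : HasFiniteProjectiveDimension R T
  selfOrthogonal : IsSelfOrthogonal R T
  coresolution : HasFiniteAddCoresolution R T

/-- Wakamatsu-tilting modules. If endomorphisms of the left module `T` are written on the right
and `S` is the resulting endomorphism ring, then `Module.End R T` is the opposite ring `Sᵒᵖ`, and
the right `S`-module `T_S` is the left `Module.End R T`-module `T`. The field `balanced` says that
the canonical ring homomorphism `R → End(T_S)` is an isomorphism. -/
structure IsWakamatsuTilting (R : Type u) [Ring R] (T : Type u) [AddCommGroup T] [Module R T] :
    Prop where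
  mem_mod : HasFGProjectiveResolution R T
  mem_mod_end : HasFGProjectiveResolution (Module.End R T) T
  balanced : Function.Bijective
    (Module.toModuleEnd (Module.End R T) T : R →+* Module.End (Module.End R T) T)
  selfOrthogonal : IsSelfOrthogonal R T
  selfOrthogonal_end : IsSelfOrthogonal (Module.End R T) T

/-- The statement (PWTC) for the ring `R`: every Wakamatsu-tilting `R`-module of finite projective
dimension is tilting. -/
def PWTC (R : Type u) [Ring R] : Prop :=
  ∀ (T : Type u) [AddCommGroup T] [Module R T],
    IsWakamatsuTilting R T → HasFiniteProjectiveDimension R T → IsTilting R T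

/-- The statement (EWTC) for the ring `R`: every `T ∈ mod R` that is self-orthogonal and admits a
finite `add T`-coresolution of `R` is tilting. -/
def EWTC (R : Type u) [Ring R] : Prop :=
  ∀ (T : Type u) [AddCommGroup T] [Module R T],
    HasFGProjectiveResolution R T → IsSelfOrthogonal R T → HasFiniteAddCoresolution R T →
      IsTilting R T

end Defs

end WTilting

/-! Let `A` be the endomorphism ring of `T`. The functor `Hom_R(-, T)` turns a finite resolution of
`T` by finitely generated projectives into a finite `add T`-coresolution of `A`
(`hasAddCoresolutionLE_hom`). It also turns a finite `add T`-coresolution of `R` into a finite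
projective resolution of `T` over `A` (`HasAddCoresolutionLE.hom`). Self-orthogonality keeps the
dualized sequences exact. The second passage also yields self-orthogonality over `A` and `End_A T =
R`.

So finite projective dimension over one ring corresponds to (T3) over the other. Given (PWTC), a
module as in (EWTC) is Wakamatsu-tilting of finite projective dimension over `A`, hence tilting
there, and its coresolution over `A` dualizes back to finite projective dimension over `R`. Given
(EWTC), a Wakamatsu-tilting module of finite projective dimension satisfies the hypotheses of (EWTC)
over `A`, and its finite projective dimension over `A` dualizes back to (T3) over `R`. -/

namespace WTilting

open Abelian

/-! ### Vanishing of Ext and dimension shifting. -/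

section ExtVanishing

variable {R : Type u} [Ring R]

/-- `Ext_R^i(M, N) = 0` for all `i > 0`. -/
def IsExtOrthogonal (R : Type u) [Ring R] (M N : Type u) [AddCommGroup M] [Module R M]
    [AddCommGroup N] [Module R N] : Prop :=
  ∀ i : ℕ, Subsingleton (Ext (ModuleCat.of R M) (ModuleCat.of R N) (i + 1))

variable {K P M N T : Type u} [AddCommGroup K] [Module R K] [AddCommGroup P] [Module R P]
  [AddCommGroup M] [Module R M] [AddCommGroup N] [Module R N] [AddCommGroup T] [Module R T]

theorem isSelfOrthogonal_iff : IsSelfOrthogonal R T ↔ IsExtOrthogonal R T T := by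
  refine ⟨fun h i ↦ h (i + 1) i.succ_pos, fun h i hi ↦ ?_⟩
  obtain ⟨j, rfl⟩ := Nat.exists_eq_add_one_of_ne_zero hi.ne'
  exact h j

/-- The short complex in `ModuleCat R` given by an exact pair of linear maps. -/
abbrev shortComplex (f : K →ₗ[R] P) (g : P →ₗ[R] M) (h : Function.Exact f g) :
    ShortComplex (ModuleCat.{u} R) :=
  ShortComplex.mk (ModuleCat.ofHom f) (ModuleCat.ofHom g) (by
    ext x; exact h.apply_apply_eq_zero x)

theorem shortComplex_shortExact {f : K →ₗ[R] P} {g : P →ₗ[R] M} (hf : Function.Injective f)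
    (h : Function.Exact f g) (hg : Function.Surjective g) : (shortComplex f g h).ShortExact :=
  ModuleCat.shortComplex_shortExact _ h hf hg

theorem IsExtOrthogonal.of_projective [Module.Projective R P] : IsExtOrthogonal R P N := by
  intro i
  have : Projective (ModuleCat.of R P) := (IsProjective.iff_projective P).1 ‹_›
  exact Ext.subsingleton_of_projective _ _ _

theorem IsExtOrthogonal.exists_extension {f : K →ₗ[R] P} {g : P →ₗ[R] M}
    (hf : Function.Injective f) (h : Function.Exact f g) (hg : Function.Surjective g)
    (hM : IsExtOrthogonal R M N) (φ : K →ₗ[R] N) : ∃ ψ : P →ₗ[R] N, ψ ∘ₗ f = φ := by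
  have hS := shortComplex_shortExact hf h hg
  have := hM 0
  obtain ⟨x, hx⟩ := Ext.contravariant_sequence_exact₁ hS (ModuleCat.of R N)
    (Ext.mk₀ (ModuleCat.ofHom φ)) (n₁ := 1) (add_zero 1) (Subsingleton.elim _ _)
  obtain ⟨ψ, rfl⟩ := (Ext.mk₀_bijective _ _).2 x
  refine ⟨ψ.hom, ?_⟩
  rw [Ext.mk₀_comp_mk₀] at hx
  have := (Ext.mk₀_bijective _ _).1 hx
  simpa using congrArg ModuleCat.Hom.hom this

/-- Each class comes from the connecting map. In degree one it comes from a homomorphism `K → N`,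
and extending that homomorphism to `P` kills the class. -/
theorem IsExtOrthogonal.of_exists_extension {f : K →ₗ[R] P} {g : P →ₗ[R] M}
    (hf : Function.Injective f) (h : Function.Exact f g) (hg : Function.Surjective g)
    (hP : IsExtOrthogonal R P N) (hK : IsExtOrthogonal R K N)
    (hext : ∀ φ : K →ₗ[R] N, ∃ ψ : P →ₗ[R] N, ψ ∘ₗ f = φ) : IsExtOrthogonal R M N := by
  have hS := shortComplex_shortExact hf h hg
  intro i
  refine subsingleton_of_forall_eq 0 fun x ↦ ?_
  have := hP i
  obtain ⟨y, rfl⟩ := Ext.contravariant_sequence_exact₃ hS (ModuleCat.of R N) x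
    (Subsingleton.elim _ _) (n₀ := i) (add_comm 1 i)
  cases i with
  | zero =>
    obtain ⟨φ, rfl⟩ := (Ext.mk₀_bijective _ _).2 y
    obtain ⟨ψ, hψ⟩ := hext φ.hom
    have : φ = ModuleCat.ofHom f ≫ ModuleCat.ofHom ψ := by
      ext x; exact (LinearMap.congr_fun hψ x).symm
    rw [this, ← Ext.mk₀_comp_mk₀]
    exact hS.extClass_comp_assoc _
  | succ i =>
    have := hK i
    rw [Subsingleton.elim y 0, Ext.comp_zero]

theorem IsExtOrthogonal.left {f : K →ₗ[R] P} {g : P →ₗ[R] M}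
    (hf : Function.Injective f) (h : Function.Exact f g) (hg : Function.Surjective g)
    (hP : IsExtOrthogonal R P N) (hM : IsExtOrthogonal R M N) : IsExtOrthogonal R K N := by
  have hS := shortComplex_shortExact hf h hg
  intro i
  refine subsingleton_of_forall_eq 0 fun x ↦ ?_
  have := hM (i + 1)
  obtain ⟨y, rfl⟩ := Ext.contravariant_sequence_exact₁ hS (ModuleCat.of R N) x
    (n₁ := i + 1 + 1) (add_comm 1 (i + 1)) (Subsingleton.elim _ _)
  have := hP i
  rw [Subsingleton.elim y 0, Ext.comp_zero]

/-- The identity of `M` is a sum of maps factoring through `T`, so every class is a sum of classes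
factoring through Ext groups of `T`. -/
theorem IsExtOrthogonal.of_retract_pi {n : ℕ} (a : M →ₗ[R] (Fin n → T)) (b : (Fin n → T) →ₗ[R] M)
    (hba : b ∘ₗ a = LinearMap.id) (hT : IsExtOrthogonal R T N) : IsExtOrthogonal R M N := by
  intro i
  refine subsingleton_of_forall_eq 0 fun x ↦ ?_
  have hid : 𝟙 (ModuleCat.of R M) = ∑ j : Fin n, ModuleCat.ofHom (LinearMap.proj j ∘ₗ a) ≫
      ModuleCat.ofHom (b ∘ₗ LinearMap.single R (fun _ ↦ T) j) := by
    ext m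
    simp only [ModuleCat.hom_sum, ← ModuleCat.ofHom_comp, ModuleCat.hom_ofHom, ModuleCat.hom_id,
      LinearMap.coe_sum, Finset.sum_apply, LinearMap.comp_apply, LinearMap.proj_apply,
      LinearMap.id_apply, ← map_sum]
    rw [show ∑ j, LinearMap.single R (fun _ : Fin n ↦ T) j (a m j) = a m from
      Finset.univ_sum_single (a m)]
    exact (LinearMap.congr_fun hba m).symm
  have := hT i
  rw [← Ext.mk₀_id_comp x, hid, Ext.mk₀_sum, Ext.sum_comp]
  refine Finset.sum_eq_zero fun j _ ↦ ?_
  rw [← Ext.mk₀_comp_mk₀_assoc, Subsingleton.elim ((Ext.mk₀ _).comp x _) 0, Ext.comp_zero]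

theorem hasProjectiveDimensionLE_zero_iff :
    HasProjectiveDimensionLE (ModuleCat.of R M) 0 ↔ Module.Projective R M := by
  rw [← projective_iff_hasProjectiveDimensionLE_zero]
  exact (IsProjective.iff_projective M).symm

theorem hasProjectiveDimensionLE_succ_iff [Module.Projective R P] {f : K →ₗ[R] P} {g : P →ₗ[R] M}
    (hf : Function.Injective f) (h : Function.Exact f g) (hg : Function.Surjective g) (n : ℕ) :
    HasProjectiveDimensionLE (ModuleCat.of R M) (n + 1) ↔
      HasProjectiveDimensionLE (ModuleCat.of R K) n :=
  (shortComplex_shortExact hf h hg).hasProjectiveDimensionLT_X₃_iff n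
    ((IsProjective.iff_projective P).1 ‹_›)

theorem hasProjectiveDimensionLE_of_linearEquiv (e : M ≃ₗ[R] N) (n : ℕ)
    (h : HasProjectiveDimensionLE (ModuleCat.of R M) n) :
    HasProjectiveDimensionLE (ModuleCat.of R N) n :=
  hasProjectiveDimensionLT_of_iso e.toModuleIso _

theorem IsExtOrthogonal.of_linearEquiv (e : M ≃ₗ[R] N) (h : IsExtOrthogonal R M T) :
    IsExtOrthogonal R N T := by
  intro i
  refine subsingleton_of_forall_eq 0 fun x ↦ ?_
  have := h i
  have hid : 𝟙 (ModuleCat.of R N) = ModuleCat.ofHom e.symm.toLinearMap ≫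
      ModuleCat.ofHom e.toLinearMap := by
    ext m; simp
  rw [← Ext.mk₀_id_comp x, hid, ← Ext.mk₀_comp_mk₀_assoc,
    Subsingleton.elim ((Ext.mk₀ _).comp x _) 0, Ext.comp_zero]

end ExtVanishing

/-! ### Transport of Ext vanishing along a ring isomorphism. -/

section RingEquiv

variable {R A : Type u} [Ring R] [Ring A] (e : R ≃+* A)

theorem IsExtOrthogonal.of_ringEquiv {M N : Type u} [AddCommGroup M] [Module R M] [Module A M]
    [AddCommGroup N] [Module R N] [Module A N] (hM : ∀ (r : R) (x : M), e r • x = r • x)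
    (hN : ∀ (r : R) (x : N), e r • x = r • x) (h : IsExtOrthogonal R M N) :
    IsExtOrthogonal A M N := by
  intro i
  let F := (ModuleCat.restrictScalarsEquivalenceOfRingEquiv e).functor
  let eM : F.obj (ModuleCat.of A M) ≃ₗ[R] M :=
    { AddEquiv.refl M with map_smul' := hM }
  let eN : F.obj (ModuleCat.of A N) ≃ₗ[R] N :=
    { AddEquiv.refl N with map_smul' := hN }
  have hb := F.mapExt_bijective_of_preservesProjectiveObjects
    (ModuleCat.of A M) (ModuleCat.of A N) (i + 1)
  have := h i
  refine ⟨fun x y ↦ hb.1 ?_⟩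
  -- The restricted modules are only isomorphic to `M` and `N`, so `z` is conjugated by `eM` and
  -- `eN`.
  have hz : ∀ z : Ext (F.obj (ModuleCat.of A M)) (F.obj (ModuleCat.of A N)) (i + 1), z = 0 := by
    intro z
    have h₁ := eM.toModuleIso.hom_inv_id.symm
    have h₂ := eN.toModuleIso.hom_inv_id.symm
    rw [← Ext.mk₀_id_comp z, ← Ext.comp_mk₀_id z, h₁, h₂, ← Ext.mk₀_comp_mk₀ eN.toModuleIso.hom,
      ← Ext.mk₀_comp_mk₀_assoc,
      ← Ext.comp_assoc z (Ext.mk₀ eN.toModuleIso.hom) (Ext.mk₀ eN.toModuleIso.inv)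
        (add_zero _) (add_zero _) (add_zero _),
      ← Ext.comp_assoc (Ext.mk₀ eM.toModuleIso.inv) _ (Ext.mk₀ eN.toModuleIso.inv) (zero_add _)
        (add_zero _) (by simp),
      Subsingleton.elim (Ext.comp (Ext.mk₀ eM.toModuleIso.inv) _ _) 0, Ext.zero_comp,
      Ext.comp_zero]
  rw [hz (F.mapExtAddHom _ _ _ x), hz (F.mapExtAddHom _ _ _ y)]

end RingEquiv

/-! ### Splicing exact sequences. -/

section Splice

variable {R : Type u} [Ring R]

theorem exact_comp_of_injective {K L M N : Type*} [AddCommGroup K] [Module R K]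
    [AddCommGroup L] [Module R L] [AddCommGroup M] [Module R M] [AddCommGroup N] [Module R N]
    {e : K →ₗ[R] L} {f : L →ₗ[R] M} {g : M →ₗ[R] N} (h : Function.Exact e f)
    (hg : Function.Injective g) : Function.Exact e (g ∘ₗ f) := by
  intro y
  rw [← h y, LinearMap.comp_apply, map_eq_zero_iff g hg]

theorem exact_comp_of_surjective {K L M N : Type*} [AddCommGroup K] [Module R K]
    [AddCommGroup L] [Module R L] [AddCommGroup M] [Module R M] [AddCommGroup N] [Module R N]
    {e : K →ₗ[R] L} {f : L →ₗ[R] M} {g : M →ₗ[R] N} (h : Function.Exact f g)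
    (he : Function.Surjective e) : Function.Exact (f ∘ₗ e) g := by
  intro y
  rw [h y, LinearMap.coe_comp, he.range_comp]

theorem exact_zero_of_surjective {K L M : Type*} [AddCommGroup K] [Module R K]
    [AddCommGroup L] [Module R L] [AddCommGroup M] [Module R M] {f : K →ₗ[R] L}
    (hf : Function.Surjective f) (g : L →ₗ[R] M) (hg : ∀ x, g x = 0) : Function.Exact f g :=
  fun y ↦ ⟨fun _ ↦ hf y, fun _ ↦ hg y⟩

/-- Prepend a module to a sequence of modules. -/
abbrev consModule (X : ModuleCat.{u} R) (Y : ℕ → ModuleCat.{u} R) : ℕ → ModuleCat.{u} R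
  | 0 => X
  | i + 1 => Y i

end Splice

/-! ### Resolutions by finitely generated projectives. -/

section ProjectiveResolution

variable {R : Type u} [Ring R] {K P M N : Type u} [AddCommGroup K] [Module R K] [AddCommGroup P]
  [Module R P] [AddCommGroup M] [Module R M] [AddCommGroup N] [Module R N]

theorem HasFGProjectiveResolution.cons [Module.Finite R P] [Module.Projective R P]
    {f : K →ₗ[R] P} {g : P →ₗ[R] M} (hf : Function.Injective f) (h : Function.Exact f g)
    (hg : Function.Surjective g) (hK : HasFGProjectiveResolution R K) :
    HasFGProjectiveResolution R M := by
  obtain ⟨Q, d, ε, hQ, hε, hd₀, hd⟩ := hK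
  let d' : ∀ i, consModule (ModuleCat.of R P) Q (i + 1) →ₗ[R] consModule (ModuleCat.of R P) Q i :=
    fun
    | 0 => (f ∘ₗ ε : Q 0 →ₗ[R] P)
    | i + 1 => d i
  refine ⟨consModule (ModuleCat.of R P) Q, d', g, ?_, hg, exact_comp_of_surjective h hε, ?_⟩
  · rintro (_ | i)
    · exact ⟨‹_›, ‹_›⟩
    · exact hQ i
  · rintro (_ | i)
    · exact exact_comp_of_injective hd₀ hf
    · exact hd i

theorem HasFGProjectiveResolution.of_projective [Module.Finite R M] [Module.Projective R M] :
    HasFGProjectiveResolution R M := by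
  have h0 : HasFGProjectiveResolution R PUnit.{u + 1} := by
    refine ⟨fun _ ↦ ModuleCat.of R PUnit.{u + 1}, fun _ ↦ 0, 0, fun _ ↦ ⟨?_, ?_⟩,
      Function.surjective_to_subsingleton _, ?_, fun _ ↦ ?_⟩
    · infer_instance
    · infer_instance
    · exact fun y ↦ ⟨fun _ ↦ ⟨0, rfl⟩, fun _ ↦ rfl⟩
    · exact fun y ↦ ⟨fun _ ↦ ⟨0, rfl⟩, fun _ ↦ rfl⟩
  refine h0.cons (f := (0 : PUnit.{u + 1} →ₗ[R] M)) (g := LinearMap.id)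
    (Function.injective_of_subsingleton _) ?_ Function.surjective_id
  exact fun y ↦ ⟨fun h ↦ ⟨0, h.symm⟩, fun ⟨_, h⟩ ↦ h.symm⟩

theorem HasFGProjectiveResolution.exists_syzygy (hM : HasFGProjectiveResolution R M) :
    ∃ (K P : ModuleCat.{u} R) (f : K →ₗ[R] P) (g : P →ₗ[R] M), Module.Finite R P ∧
      Module.Projective R P ∧ Function.Injective f ∧ Function.Exact f g ∧ Function.Surjective g ∧
      HasFGProjectiveResolution R K := by
  obtain ⟨P, d, ε, hP, hε, hd₀, hd⟩ := hM
  refine ⟨ModuleCat.of R (LinearMap.ker ε), P 0, (LinearMap.ker ε).subtype, ε, (hP 0).1, (hP 0).2,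
    Subtype.val_injective, LinearMap.exact_subtype_ker_map ε, hε, fun i ↦ P (i + 1),
    fun i ↦ d (i + 1), (d 0).codRestrict _ fun x ↦ hd₀.apply_apply_eq_zero x,
    fun i ↦ hP (i + 1), ?_, ?_, fun i ↦ hd (i + 1)⟩
  · rintro ⟨y, hy⟩
    obtain ⟨x, rfl⟩ := (hd₀ y).1 hy
    exact ⟨x, rfl⟩
  · intro y
    rw [← hd 0 y]
    exact Subtype.ext_iff

theorem HasFGProjectiveResolution.finite (hM : HasFGProjectiveResolution R M) :
    Module.Finite R M := by
  obtain ⟨K, P, f, g, _, _, _, _, hg, _⟩ := hM.exists_syzygy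
  exact Module.Finite.of_surjective g hg

theorem HasFGProjectiveResolution.of_linearEquiv (e : M ≃ₗ[R] N)
    (hM : HasFGProjectiveResolution R M) : HasFGProjectiveResolution R N := by
  obtain ⟨P, d, ε, hP, hε, hd₀, hd⟩ := hM
  exact ⟨P, d, e.toLinearMap ∘ₗ ε, hP, e.surjective.comp hε,
    exact_comp_of_injective hd₀ e.injective, hd⟩

theorem HasFGProjectiveResolution.of_ringEquiv {A : Type u} [Ring A] [Module A M] (e : R ≃+* A)
    (he : ∀ (r : R) (x : M), e r • x = r • x) (hM : HasFGProjectiveResolution R M) :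
    HasFGProjectiveResolution A M := by
  obtain ⟨P, d, ε, hP, hε, hd₀, hd⟩ := hM
  let F := ModuleCat.restrictScalars.{u} e.symm.toRingHom
  let _ := RingHomInvPair.of_ringEquiv e
  let _ : RingHomInvPair (e.symm : A →+* R) (e : R →+* A) := RingHomInvPair.symm _ _
  let ι : ∀ i, P i ≃ₛₗ[(e : R →+* A)] F.obj (P i) := fun i ↦
    { AddEquiv.refl (P i) with
      map_smul' := fun r x ↦ by
        change r • x = e.symm (e r) • x
        rw [e.symm_apply_apply] }
  let ε' : F.obj (P 0) →ₗ[A] M :=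
    { toFun := ε
      map_add' := ε.map_add
      map_smul' := fun a x ↦ by
        change ε (e.symm a • x) = a • ε x
        refine (ε.map_smul (e.symm a) x).trans ?_
        rw [← he, e.apply_symm_apply] }
  refine ⟨fun i ↦ F.obj (P i), fun i ↦ (F.map (ModuleCat.ofHom (d i))).hom, ε', fun i ↦ ⟨?_, ?_⟩,
    hε, hd₀, hd⟩
  · have := (hP i).1
    exact Module.Finite.of_surjective (ι i).toLinearMap (ι i).surjective
  · have := (hP i).2
    exact Module.Projective.of_equiv (ι i)

end ProjectiveResolution

/-! ### Finite `add T`-coresolutions. -/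

section AddCoresolution

variable {R : Type u} [Ring R] {T : Type u} [AddCommGroup T] [Module R T]
  {N X C : Type u} [AddCommGroup N] [Module R N] [AddCommGroup X] [Module R X] [AddCommGroup C]
  [Module R C]

theorem memAdd_iff_exists_retract : MemAdd R T X ↔
    ∃ (n : ℕ) (a : X →ₗ[R] (Fin n → T)) (b : (Fin n → T) →ₗ[R] X), b ∘ₗ a = LinearMap.id := by
  constructor
  · rintro ⟨n, p, q, hpq, ⟨e⟩⟩
    refine ⟨n, p.subtype ∘ₗ e.toLinearMap, e.symm.toLinearMap ∘ₗ p.projectionOnto q hpq, ?_⟩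
    ext x
    simp
  · rintro ⟨n, a, b, hba⟩
    have hinj : Function.Injective a := Function.LeftInverse.injective (LinearMap.congr_fun hba)
    have hba' : ∀ x, b (a x) = x := LinearMap.congr_fun hba
    refine ⟨n, LinearMap.range a, LinearMap.ker b, ⟨?_, ?_⟩,
      ⟨LinearEquiv.ofInjective a hinj⟩⟩
    · rw [Submodule.disjoint_def]
      rintro _ ⟨x, rfl⟩ hx
      rw [← hba' x, LinearMap.mem_ker.1 hx, map_zero]
    · rw [codisjoint_iff, eq_top_iff]
      rintro y -
      refine Submodule.mem_sup.2 ⟨a (b y), ⟨b y, rfl⟩, y - a (b y), ?_, add_sub_cancel _ _⟩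
      rw [LinearMap.mem_ker, map_sub, hba', sub_self]

/-- There is an exact sequence `0 → N → X 0 → ⋯ → X n → 0` with each `X i ∈ add T`, continued by
zero modules. -/
def HasAddCoresolutionLE (R : Type u) [Ring R] (T : Type u) [AddCommGroup T] [Module R T]
    (N : Type u) [AddCommGroup N] [Module R N] (n : ℕ) : Prop :=
  ∃ (X : ℕ → ModuleCat.{u} R) (f : N →ₗ[R] X 0) (d : ∀ i, X i →ₗ[R] X (i + 1)),
    (∀ i, i ≤ n → MemAdd R T (X i)) ∧ (∀ i, n < i → Subsingleton (X i)) ∧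
      Function.Injective f ∧ Function.Exact f (d 0) ∧
        ∀ i, Function.Exact (d i) (d (i + 1))

theorem MemAdd.of_linearEquiv (e : X ≃ₗ[R] N) (h : MemAdd R T X) : MemAdd R T N := by
  obtain ⟨n, p, q, hpq, ⟨e'⟩⟩ := h
  exact ⟨n, p, q, hpq, ⟨e.symm.trans e'⟩⟩

theorem hasAddCoresolutionLE_zero_iff : HasAddCoresolutionLE R T N 0 ↔ MemAdd R T N := by
  constructor
  · rintro ⟨X, f, d, hX, h0, hf, hd₀, hd⟩
    have := h0 1 one_pos
    have hs : Function.Surjective f := fun y ↦ (hd₀ y).1 (Subsingleton.elim _ _)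
    exact (hX 0 le_rfl).of_linearEquiv (LinearEquiv.ofBijective f ⟨hf, hs⟩).symm
  · intro h
    refine ⟨consModule (ModuleCat.of R N) fun _ ↦ ModuleCat.of R PUnit.{u + 1}, LinearMap.id,
      fun _ ↦ 0, ?_, ?_, Function.injective_id, ?_, ?_⟩
    · rintro (_ | i) hi
      · exact h
      · omega
    · rintro (_ | i) hi
      · omega
      · exact inferInstanceAs (Subsingleton PUnit.{u + 1})
    · exact exact_zero_of_surjective Function.surjective_id _ fun _ ↦ rfl
    · exact fun i y ↦ ⟨fun _ ↦ ⟨0, Subsingleton.elim (α := PUnit.{u + 1}) _ _⟩, fun _ ↦ rfl⟩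

theorem HasAddCoresolutionLE.cons {n : ℕ} (hX : MemAdd R T X) {f : N →ₗ[R] X} {g : X →ₗ[R] C}
    (hf : Function.Injective f) (h : Function.Exact f g) (hg : Function.Surjective g)
    (hC : HasAddCoresolutionLE R T C n) : HasAddCoresolutionLE R T N (n + 1) := by
  obtain ⟨Y, ε, d, hY, h0, hε, hd₀, hd⟩ := hC
  let d' : ∀ i, consModule (ModuleCat.of R X) Y i →ₗ[R] consModule (ModuleCat.of R X) Y (i + 1) :=
    fun
    | 0 => (ε ∘ₗ g : X →ₗ[R] Y 0)
    | i + 1 => d i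
  refine ⟨consModule (ModuleCat.of R X) Y, f, d', ?_, ?_, hf, exact_comp_of_injective h hε, ?_⟩
  · rintro (_ | i) hi
    · exact hX
    · exact hY i (by omega)
  · rintro (_ | i) hi
    · omega
    · exact h0 i (by omega)
  · rintro (_ | i)
    · exact exact_comp_of_surjective hd₀ hg
    · exact hd i

theorem HasAddCoresolutionLE.exists_cosyzygy {n : ℕ} (hN : HasAddCoresolutionLE R T N (n + 1)) :
    ∃ (X C : ModuleCat.{u} R) (f : N →ₗ[R] X) (g : X →ₗ[R] C), MemAdd R T X ∧
      Function.Injective f ∧ Function.Exact f g ∧ Function.Surjective g ∧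
      HasAddCoresolutionLE R T C n := by
  obtain ⟨X, f, d, hX, h0, hf, hd₀, hd⟩ := hN
  refine ⟨X 0, ModuleCat.of R (LinearMap.range (d 0)), f, (d 0).rangeRestrict, hX 0 n.succ_pos.le,
    hf, fun y ↦ ?_, (d 0).surjective_rangeRestrict, fun i ↦ X (i + 1),
    (LinearMap.range (d 0)).subtype, fun i ↦ d (i + 1), fun i hi ↦ hX _ (by omega),
    fun i hi ↦ h0 _ (by omega), Subtype.val_injective, fun y ↦ ?_, fun i ↦ hd (i + 1)⟩
  · rw [← hd₀ y]
    exact Subtype.ext_iff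
  · rw [hd 0 y]
    exact ⟨fun ⟨x, hx⟩ ↦ ⟨⟨y, x, hx⟩, rfl⟩, fun ⟨⟨_, x, hx⟩, hy⟩ ↦ ⟨x, hx.trans hy⟩⟩

theorem HasAddCoresolutionLE.of_linearEquiv {n : ℕ} (e : N ≃ₗ[R] C)
    (h : HasAddCoresolutionLE R T N n) : HasAddCoresolutionLE R T C n := by
  obtain ⟨X, f, d, hX, h0, hf, hd₀, hd⟩ := h
  exact ⟨X, f ∘ₗ e.symm.toLinearMap, d, hX, h0, hf.comp e.symm.injective,
    exact_comp_of_surjective hd₀ e.symm.surjective, hd⟩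

end AddCoresolution

/-! ### The duality `Hom_R(-, T)` from `R`-modules to `A`-modules. -/

section Duality

variable {R A : Type u} [Ring R] [Ring A] {T : Type u} [AddCommGroup T] [Module R T] [Module A T]
  [SMulCommClass R A T]
  {K P M N : Type u} [AddCommGroup K] [Module R K] [AddCommGroup P] [Module R P]
  [AddCommGroup M] [Module R M] [AddCommGroup N] [Module R N]

theorem lcomp_injective {g : P →ₗ[R] M} (hg : Function.Surjective g) :
    Function.Injective (LinearMap.lcomp A T g) := fun _ _ h ↦
  LinearMap.ext fun y ↦ by
    obtain ⟨x, rfl⟩ := hg y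
    exact LinearMap.congr_fun h x

theorem lcomp_exact {f : K →ₗ[R] P} {g : P →ₗ[R] M} (h : Function.Exact f g)
    (hg : Function.Surjective g) :
    Function.Exact (LinearMap.lcomp A T g) (LinearMap.lcomp A T f) := by
  intro φ
  constructor
  · intro hφ
    let e := LinearMap.quotKerEquivOfSurjective g hg
    have hker : LinearMap.ker g ≤ LinearMap.ker φ := by
      intro x hx
      obtain ⟨y, rfl⟩ := (h x).1 hx
      exact LinearMap.congr_fun hφ y
    refine ⟨(LinearMap.ker g).liftQ φ hker ∘ₗ e.symm.toLinearMap, ?_⟩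
    ext x
    have : e.symm (g x) = (LinearMap.ker g).mkQ x := by
      rw [LinearEquiv.symm_apply_eq]; rfl
    simp [this]
  · rintro ⟨ψ, rfl⟩
    ext x
    simp [h.apply_apply_eq_zero]

theorem lcomp_surjective {f : K →ₗ[R] P} {g : P →ₗ[R] M}
    (hf : Function.Injective f) (h : Function.Exact f g) (hg : Function.Surjective g)
    (hM : IsExtOrthogonal R M T) : Function.Surjective (LinearMap.lcomp A T f) := fun φ ↦
  hM.exists_extension hf h hg φ

theorem lcomp_comp_lcomp_eq_id {a : M →ₗ[R] P} {b : P →ₗ[R] M} (h : b ∘ₗ a = LinearMap.id) :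
    LinearMap.lcomp A T a ∘ₗ LinearMap.lcomp A T b = LinearMap.id := by
  ext φ x
  exact congrArg φ (LinearMap.congr_fun h x)

/-- `P` is a retract of some `R^n`, and `Hom_R(R^n, T)` is `T^n`. -/
theorem memAdd_hom_of_projective [Module.Finite R P] [Module.Projective R P] :
    MemAdd A T (P →ₗ[R] T) := by
  obtain ⟨n, b, hb⟩ := Module.Finite.exists_fin' R P
  obtain ⟨a, ha⟩ := Module.projective_lifting_property b LinearMap.id hb
  let e : ((Fin n → R) →ₗ[R] T) ≃ₗ[A] (Fin n → T) :=
    (LinearMap.lsum R (fun _ : Fin n ↦ R) A).symm.trans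
      (LinearEquiv.piCongrRight fun _ ↦ LinearMap.ringLmapEquivSelf R A T)
  refine memAdd_iff_exists_retract.2 ⟨n, e.toLinearMap ∘ₗ LinearMap.lcomp A T b,
    LinearMap.lcomp A T a ∘ₗ e.symm.toLinearMap, ?_⟩
  rw [← lcomp_comp_lcomp_eq_id ha]
  ext φ x
  simp

/-- The canonical map from `N` to its bidual with respect to `T` is bijective. -/
def IsHomReflexive (R A T N : Type u) [Ring R] [Ring A] [AddCommGroup T] [Module R T] [Module A T]
    [SMulCommClass R A T] [AddCommGroup N] [Module R N] : Prop :=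
  ∀ φ : (N →ₗ[R] T) →ₗ[A] T, ∃! x : N, ∀ f : N →ₗ[R] T, φ f = f x

theorem IsHomReflexive.eq_of_forall_eq (h : IsHomReflexive R A T N) {x y : N}
    (hxy : ∀ f : N →ₗ[R] T, f x = f y) : x = y :=
  (h (LinearMap.applyₗ' A y)).unique (fun f ↦ (hxy f).symm) fun _ ↦ rfl

/-- A diagram chase: a functional on `Hom(K, T)`, pulled back to `Hom(P, T)`, is evaluation at some
`x`. Maps `M → T` separate points, which forces `g x = 0`, so `x` comes from `K`. -/
theorem IsHomReflexive.left {f : K →ₗ[R] P} {g : P →ₗ[R] M}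
    (hf : Function.Injective f) (h : Function.Exact f g) (hT : IsExtOrthogonal R M T)
    (hg : Function.Surjective g) (hP : IsHomReflexive R A T P) (hM : IsHomReflexive R A T M) :
    IsHomReflexive R A T K := by
  intro φ
  obtain ⟨x, hx, -⟩ := hP (φ ∘ₗ LinearMap.lcomp A T f)
  have hgx : g x = 0 := by
    refine hM.eq_of_forall_eq fun k ↦ ?_
    have := (lcomp_exact (A := A) (T := T) h hg).apply_apply_eq_zero k
    rw [map_zero]
    exact (hx (LinearMap.lcomp A T g k)).symm.trans ((congrArg φ this).trans (map_zero φ))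
  obtain ⟨y, rfl⟩ := (h x).1 hgx
  refine ⟨y, fun k ↦ ?_, fun z hz ↦ hf (hP.eq_of_forall_eq fun k ↦ ?_)⟩
  · obtain ⟨k, rfl⟩ := lcomp_surjective (A := A) hf h hg hT k
    exact hx k
  · exact (hz (LinearMap.lcomp A T f k)).symm.trans (hx k)

/-- Induction along syzygies: orthogonality to `T` keeps each dualized short exact sequence exact
and passes to the syzygy. -/
theorem hasAddCoresolutionLE_hom (n : ℕ) :
    ∀ (M : Type u) [AddCommGroup M] [Module R M], HasFGProjectiveResolution R M →
      HasProjectiveDimensionLE (ModuleCat.of R M) n → IsExtOrthogonal R M T →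
        HasAddCoresolutionLE A T (M →ₗ[R] T) n := by
  induction n with
  | zero =>
    intro M _ _ hM hn _
    have := hM.finite
    have := hasProjectiveDimensionLE_zero_iff.1 hn
    exact hasAddCoresolutionLE_zero_iff.2 memAdd_hom_of_projective
  | succ n ih =>
    intro M _ _ hM hn hT
    obtain ⟨K, P, f, g, _, _, hf, h, hg, hK⟩ := hM.exists_syzygy
    exact HasAddCoresolutionLE.cons memAdd_hom_of_projective (lcomp_injective hg)
      (lcomp_exact h hg) (lcomp_surjective hf h hg hT) (ih K hK
        ((hasProjectiveDimensionLE_succ_iff hf h hg n).1 hn)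
        (IsExtOrthogonal.left hf h hg IsExtOrthogonal.of_projective hT))

theorem HasAddCoresolutionLE.isExtOrthogonal (hT : IsExtOrthogonal R T T) (n : ℕ) :
    ∀ (N : Type u) [AddCommGroup N] [Module R N], HasAddCoresolutionLE R T N n →
      IsExtOrthogonal R N T := by
  have hadd : ∀ (X : Type u) [AddCommGroup X] [Module R X], MemAdd R T X →
      IsExtOrthogonal R X T := by
    intro X _ _ hX
    obtain ⟨n, a, b, hba⟩ := memAdd_iff_exists_retract.1 hX
    exact .of_retract_pi a b hba hT
  induction n with
  | zero =>
    intro N _ _ hN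
    exact hadd N (hasAddCoresolutionLE_zero_iff.1 hN)
  | succ n ih =>
    intro N _ _ hN
    obtain ⟨X, C, f, g, hX, hf, h, hg, hC⟩ := hN.exists_cosyzygy
    exact .left hf h hg (hadd X hX) (ih C hC)

variable [SMulCommClass A R T]

/-- The ring `A`, as a left module over itself, is identified with `End_R T` when every
endomorphism of `T` is given by a unique element of `A`. -/
noncomputable def endLinearEquiv
    (hA : Function.Bijective (Module.toModuleEnd R T : A →+* Module.End R T)) :
    A ≃ₗ[A] (T →ₗ[R] T) :=
  LinearEquiv.ofBijective
    { toFun := fun a ↦ Module.toModuleEnd R T a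
      map_add' := map_add _
      map_smul' := fun a b ↦ by
        ext x
        exact mul_smul a b x } hA

theorem finite_projective_hom_of_memAdd
    (hA : Function.Bijective (Module.toModuleEnd R T : A →+* Module.End R T))
    (hM : MemAdd R T M) :
    Module.Finite A (M →ₗ[R] T) ∧ Module.Projective A (M →ₗ[R] T) := by
  obtain ⟨n, a, b, hba⟩ := memAdd_iff_exists_retract.1 hM
  let e : (Fin n → A) ≃ₗ[A] ((Fin n → T) →ₗ[R] T) :=
    (LinearEquiv.piCongrRight fun _ ↦ endLinearEquiv hA).trans
      (LinearMap.lsum R (fun _ : Fin n ↦ T) A)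
  have hs : (LinearMap.lcomp A T a ∘ₗ e.toLinearMap) ∘ₗ (e.symm.toLinearMap ∘ₗ
      LinearMap.lcomp A T b) = LinearMap.id := by
    rw [← lcomp_comp_lcomp_eq_id hba]
    ext φ x
    simp
  exact ⟨Module.Finite.of_surjective (LinearMap.lcomp A T a ∘ₗ e.toLinearMap)
    (Function.RightInverse.surjective (LinearMap.congr_fun hs)), Module.Projective.of_split _ _ hs⟩

theorem IsHomReflexive.of_memAdd
    (hA : Function.Bijective (Module.toModuleEnd R T : A →+* Module.End R T))
    (hM : MemAdd R T M) : IsHomReflexive R A T M := by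
  obtain ⟨n, a, b, hba⟩ := memAdd_iff_exists_retract.1 hM
  have hba' : ∀ x, b (a x) = x := LinearMap.congr_fun hba
  intro φ
  refine ⟨b fun j ↦ φ (LinearMap.proj j ∘ₗ a), fun f ↦ ?_, fun x hx ↦ ?_⟩
  -- The components of `f ∘ b` are endomorphisms of `T`, hence scalars from `A`. Thus `f` is an
  -- `A`-combination of the coordinates of `a`, and `φ` is determined by its values on these.
  · choose c hc using fun j : Fin n ↦ hA.2 (f ∘ₗ b ∘ₗ LinearMap.single R (fun _ ↦ T) j)
    have hc' : ∀ j t, f (b (Pi.single j t)) = c j • t := fun j t ↦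
      (LinearMap.congr_fun (hc j) t).symm
    have hfb : ∀ y : Fin n → T, f (b y) = ∑ j, c j • y j := by
      intro y
      conv_lhs => rw [← Finset.univ_sum_single y]
      simp only [map_sum, hc']
    have hf : f = ∑ j, c j • (LinearMap.proj j ∘ₗ a) := by
      ext x
      rw [← hba' x, hfb]
      simp [hba']
    rw [hfb]
    conv_lhs => rw [hf]
    simp only [map_sum, map_smul]
  · simp only [hx, LinearMap.comp_apply, LinearMap.proj_apply]
    exact (hba' x).symm

/-- Induction along cosyzygies. The four conclusions are proved together because the vanishing of
the first Ext group at the next stage relies on reflexivity of the cosyzygy. -/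
theorem HasAddCoresolutionLE.hom
    (hA : Function.Bijective (Module.toModuleEnd R T : A →+* Module.End R T))
    (hT : IsExtOrthogonal R T T) (n : ℕ) :
    ∀ (N : Type u) [AddCommGroup N] [Module R N], HasAddCoresolutionLE R T N n →
      HasFGProjectiveResolution A (N →ₗ[R] T) ∧
      HasProjectiveDimensionLE (ModuleCat.of A (N →ₗ[R] T)) n ∧
      IsExtOrthogonal A (N →ₗ[R] T) T ∧ IsHomReflexive R A T N := by
  induction n with
  | zero =>
    intro N _ _ hN
    rw [hasAddCoresolutionLE_zero_iff] at hN
    obtain ⟨_, _⟩ := finite_projective_hom_of_memAdd hA hN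
    exact ⟨.of_projective, hasProjectiveDimensionLE_zero_iff.2 ‹_›, .of_projective,
      .of_memAdd hA hN⟩
  | succ n ih =>
    intro N _ _ hN
    obtain ⟨X, C, f, g, hX, hf, h, hg, hC⟩ := hN.exists_cosyzygy
    obtain ⟨_, _⟩ := finite_projective_hom_of_memAdd hA hX
    obtain ⟨hC₁, hC₂, hC₃, hC₄⟩ := ih C hC
    have hCT := HasAddCoresolutionLE.isExtOrthogonal hT n C hC
    have hi := lcomp_injective (A := A) (T := T) hg
    have he := lcomp_exact (A := A) (T := T) h hg
    have hs := lcomp_surjective (A := A) hf h hg hCT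
    refine ⟨hC₁.cons hi he hs, (hasProjectiveDimensionLE_succ_iff hi he hs n).2 hC₂,
      .of_exists_extension hi he hs .of_projective hC₃ fun φ ↦ ?_,
      .left hf h hCT hg (.of_memAdd hA hX) hC₄⟩
    -- By reflexivity `φ` is evaluation at some `c` in `C`; evaluation at a preimage of `c` in `X`
    -- extends it to `Hom(X, T)`.
    obtain ⟨c, hc, -⟩ := hC₄ φ
    obtain ⟨x, rfl⟩ := hg c
    refine ⟨LinearMap.applyₗ' A x, ?_⟩
    ext k
    exact (hc k).symm

end Duality

/-! ### Exchange of properties of `T` between `R` and `A`, the case `Hom_R(R, T) = T`. -/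

section Bimodule

variable {R A : Type u} [Ring R] [Ring A] {T : Type u} [AddCommGroup T] [Module R T] [Module A T]
  [SMulCommClass R A T] [SMulCommClass A R T]

/-- A self-orthogonal `T ∈ mod R` of finite projective dimension yields a finite
`add T`-coresolution of its endomorphism ring. -/
theorem hasFiniteAddCoresolution_of_finite_pd
    (hA : Function.Bijective (Module.toModuleEnd R T : A →+* Module.End R T))
    (hT : HasFGProjectiveResolution R T) (ho : IsSelfOrthogonal R T)
    (hpd : HasFiniteProjectiveDimension R T) : HasFiniteAddCoresolution A T := by
  obtain ⟨n, hn⟩ := hpd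
  exact ⟨n, (hasAddCoresolutionLE_hom n T hT hn
    (isSelfOrthogonal_iff.1 ho)).of_linearEquiv (endLinearEquiv hA).symm⟩

theorem hasFGProjectiveResolution_of_coresolution
    (hA : Function.Bijective (Module.toModuleEnd R T : A →+* Module.End R T))
    (ho : IsSelfOrthogonal R T) (hc : HasFiniteAddCoresolution R T) :
    HasFGProjectiveResolution A T := by
  obtain ⟨n, hn⟩ := hc
  exact (HasAddCoresolutionLE.hom hA (isSelfOrthogonal_iff.1 ho) n R hn).1.of_linearEquiv
    (LinearMap.ringLmapEquivSelf R A T)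

theorem hasFiniteProjectiveDimension_of_coresolution
    (hA : Function.Bijective (Module.toModuleEnd R T : A →+* Module.End R T))
    (ho : IsSelfOrthogonal R T) (hc : HasFiniteAddCoresolution R T) :
    HasFiniteProjectiveDimension A T := by
  obtain ⟨n, hn⟩ := hc
  exact ⟨n, hasProjectiveDimensionLE_of_linearEquiv (LinearMap.ringLmapEquivSelf R A T) n
    (HasAddCoresolutionLE.hom hA (isSelfOrthogonal_iff.1 ho) n R hn).2.1⟩

theorem isSelfOrthogonal_of_coresolution
    (hA : Function.Bijective (Module.toModuleEnd R T : A →+* Module.End R T))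
    (ho : IsSelfOrthogonal R T) (hc : HasFiniteAddCoresolution R T) : IsSelfOrthogonal A T := by
  obtain ⟨n, hn⟩ := hc
  exact isSelfOrthogonal_iff.2 ((HasAddCoresolutionLE.hom hA (isSelfOrthogonal_iff.1 ho) n R
    hn).2.2.1.of_linearEquiv (LinearMap.ringLmapEquivSelf R A T))

/-- Under `Hom_R(R, T) = T`, an `A`-endomorphism of `T` is a functional on the dual of `R`, so
balancedness is reflexivity of `R`. -/
theorem balanced_of_coresolution
    (hA : Function.Bijective (Module.toModuleEnd R T : A →+* Module.End R T))
    (ho : IsSelfOrthogonal R T) (hc : HasFiniteAddCoresolution R T) :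
    Function.Bijective (Module.toModuleEnd A T : R →+* Module.End A T) := by
  obtain ⟨n, hn⟩ := hc
  have h := (HasAddCoresolutionLE.hom hA (isSelfOrthogonal_iff.1 ho) n R hn).2.2.2
  let e := LinearMap.ringLmapEquivSelf R A T
  have he : ∀ (f : R →ₗ[R] T) r, f r = r • e f := fun f r ↦ by
    simp [e, ← map_smul]
  refine ⟨fun r s hrs ↦ h.eq_of_forall_eq fun f ↦ ?_, fun φ ↦ ?_⟩
  · rw [he, he]
    exact LinearMap.congr_fun hrs (e f)
  · obtain ⟨r, hr, -⟩ := h (φ ∘ₗ e.toLinearMap)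
    refine ⟨r, LinearMap.ext fun t ↦ ?_⟩
    have := hr (e.symm t)
    rw [he, e.apply_symm_apply] at this
    simpa using this.symm

end Bimodule

/-! ### The two implications. -/

section Main

theorem moduleEnd_bijective (R T : Type u) [Ring R] [AddCommGroup T] [Module R T] :
    Function.Bijective (Module.toModuleEnd R T : Module.End R T →+* Module.End R T) :=
  Function.bijective_id

variable {R : Type u} [Ring R] {T : Type u} [AddCommGroup T] [Module R T]

/-- Makes `Module.End R T` a nonzero ring, to which the assumed conjecture applies. -/
theorem HasFiniteAddCoresolution.nontrivial [Nontrivial R] (h : HasFiniteAddCoresolution R T) :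
    Nontrivial T := by
  obtain ⟨n, X, f, d, hX, -, hf, -⟩ := h
  by_contra hT
  rw [not_nontrivial_iff_subsingleton] at hT
  obtain ⟨m, p, q, -, ⟨e⟩⟩ := hX 0 n.zero_le
  exact not_subsingleton R (e.injective.comp hf).subsingleton

theorem IsWakamatsuTilting.nontrivial [Nontrivial R] (h : IsWakamatsuTilting R T) :
    Nontrivial T := by
  by_contra hT
  rw [not_nontrivial_iff_subsingleton] at hT
  exact not_subsingleton R h.balanced.1.subsingleton

theorem IsWakamatsuTilting.isTilting [Nontrivial R]
    (H : ∀ (S : Type u) [Ring S] [Nontrivial S], EWTC S) (h : IsWakamatsuTilting R T)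
    (hpd : HasFiniteProjectiveDimension R T) : IsTilting R T := by
  have := h.nontrivial
  have hE := H (Module.End R T) T h.mem_mod_end h.selfOrthogonal_end
    (hasFiniteAddCoresolution_of_finite_pd (moduleEnd_bijective R T) h.mem_mod h.selfOrthogonal hpd)
  -- Balancedness identifies `R` with the endomorphism ring of `T` over `Module.End R T`, so the
  -- same lemma applies with the two rings exchanged.
  exact ⟨h.mem_mod, hpd, h.selfOrthogonal, hasFiniteAddCoresolution_of_finite_pd h.balanced
    hE.mem_mod hE.selfOrthogonal hE.finite_pd⟩

/-- A self-orthogonal module in `mod R` with a finite `add T`-coresolution of `R` is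
Wakamatsu-tilting over its endomorphism ring. -/
theorem isWakamatsuTilting_end_of_coresolution (hT : HasFGProjectiveResolution R T)
    (ho : IsSelfOrthogonal R T) (hc : HasFiniteAddCoresolution R T) :
    IsWakamatsuTilting (Module.End R T) T := by
  have hE := moduleEnd_bijective R T
  have hb : Function.Bijective (Module.toModuleEnd (Module.End R T) T :
      R →+* Module.End (Module.End R T) T) := balanced_of_coresolution hE ho hc
  -- The conditions over the second endomorphism ring are those over `R`, transported along `e`.
  let e := RingEquiv.ofBijective _ hb
  have he : ∀ (r : R) (x : T), e r • x = r • x := fun _ _ ↦ rfl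
  refine ⟨hasFGProjectiveResolution_of_coresolution hE ho hc, hT.of_ringEquiv e he, ⟨?_, ?_⟩,
    isSelfOrthogonal_of_coresolution hE ho hc,
    isSelfOrthogonal_iff.2 ((isSelfOrthogonal_iff.1 ho).of_ringEquiv e he he)⟩
  · exact fun a b hab ↦ LinearMap.ext fun x ↦ LinearMap.congr_fun hab x
  · intro φ
    refine ⟨⟨φ.toAddMonoidHom.toAddHom, fun r x ↦ ?_⟩, LinearMap.ext fun _ ↦ rfl⟩
    exact φ.map_smul (e r) x

theorem isTilting_of_coresolution [Nontrivial R]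
    (H : ∀ (S : Type u) [Ring S] [Nontrivial S], PWTC S) (hT : HasFGProjectiveResolution R T)
    (ho : IsSelfOrthogonal R T) (hc : HasFiniteAddCoresolution R T) : IsTilting R T := by
  have := hc.nontrivial
  have hE := moduleEnd_bijective R T
  have hE' := H (Module.End R T) T (isWakamatsuTilting_end_of_coresolution hT ho hc)
    (hasFiniteProjectiveDimension_of_coresolution hE ho hc)
  -- The rings are exchanged again: the coresolution over `Module.End R T` bounds the projective
  -- dimension over `R`.
  exact ⟨hT, hasFiniteProjectiveDimension_of_coresolution (balanced_of_coresolution hE ho hc)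
    hE'.selfOrthogonal hE'.coresolution, ho, hc⟩

end Main

end WTilting

theorem proposition3p4 :
    (∀ (R : Type u) [Ring R] [Nontrivial R], WTilting.PWTC R) ↔
      (∀ (R : Type u) [Ring R] [Nontrivial R], WTilting.EWTC R) := by
  constructor
  · intro H R _ _ T _ _ hT ho hc
    exact WTilting.isTilting_of_coresolution H hT ho hc
  · intro H R _ _ T _ _ h hpd
    exact h.isTilting H hpd
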